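/- For a partition $\lambda$ with largest part $\lambda_1$, let $\omega(\lambda)$ be the number of parts equal to $1$ and $\mu(\lambda)$ the number of parts greater than $\omega(\lambda)$. The crank of $\lambda$ is $\lambda_1$ if $\omega(\lambda)=0$ and $\mu(\lambda)-\omega(\lambda)$ if $\omega(\lambda)>0$; the empty partition has crank $0$. The top row of the Frobenius symbol of a partition lists, for each diagonal box of its Ferrers diagram, the number of boxes to the right of it in the same row. There is one partition of $0$, and there are no partitions of a negative integer. **Theorem (Hopkins, Sellers, Stanton).** Let $n\ge 0$ and $j\ge 0$ be integers. (a) If $(n,j)\ne(1,1)$, then the number of partitions $\lambda$ of $n$ with $\operatorname{crank}(\lambda)\ge j$ equals the number of partitions of $n-j$ whose Frobenius symbol has no entry $j$ in its top row. (b) For $n>1$ let $M(m,n)$ be the number of partitions of $n$ with crank $m$, and for $n\le 1$ put, as usual, $M(0,0)=M(1,1)=M(-1,1)=1$, $M(0,1)=-1$, and $M(m,n)=0$ for the other $m$. Then for all $n\ge 0$ and $j\ge 0$, including $(n,j)=(1,1)$, the finite sum $\sum_{m\ge j}M(m,n)$ equals the number of partitions of $n-j$ whose Frobenius symbol has no entry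 $j$ in its top row. -/

import Mathlib

namespace CrankFrobenius

/-- `ω(p)`: the number of parts of `p` equal to `1`. -/
def numOnes {n : ℕ} (p : n.Partition) : ℕ := p.parts.count 1

/-- `μ(p)`: the number of parts of `p` greater than `ω(p)`. -/
def numLarge {n : ℕ} (p : n.Partition) : ℕ := p.parts.countP (fun a => numOnes p < a)

/-- The Andrews–Garvan crank. The supremum of the parts is the largest part
(and `0` for the empty partition). -/
def crank {n : ℕ} (p : n.Partition) : ℤ :=
  if numOnes p = 0 then (p.parts.sup : ℤ) else (numLarge p : ℤ) - (numOnes p : ℤ)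

/-- The Ferrers diagram of a partition: row `i` has as many boxes as the `i`-th largest part. -/
def ferrers {n : ℕ} (p : n.Partition) : YoungDiagram :=
  YoungDiagram.ofRowLens (p.parts.sort (· ≥ ·)) (p.parts.pairwise_sort (· ≥ ·)).sortedGE

/-- The number of diagonal boxes of a diagram. -/
def diagLen (D : YoungDiagram) : ℕ := (D.cells.filter (fun c => c.1 = c.2)).card

/-- Top row of the Frobenius symbol: the number of boxes to the right of each diagonal box. -/
def frobeniusTop {n : ℕ} (p : n.Partition) : List ℕ :=
  (List.range (diagLen (ferrers p))).map
    (fun i => ((ferrers p).cells.filter (fun c => c.1 = i ∧ i < c.2)).card)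

/-- Number of partitions of `n` with crank at least `j`. -/
def numCrankGE (j n : ℕ) : ℕ :=
  (Finset.univ.filter (fun p : n.Partition => (j : ℤ) ≤ crank p)).card

/-- The crank numbers `M(m, n)`: the number of partitions of `n` with crank `m` for `n > 1`, with
the conventional values `M(0,0) = M(1,1) = M(-1,1) = 1`, `M(0,1) = -1` (and `0` for all other `m`)
for `n ≤ 1`. -/
def crankM (m : ℤ) (n : ℕ) : ℤ :=
  if n = 0 then (if m = 0 then 1 else 0)
  else if n = 1 then (if m = 0 then -1 else if m = 1 ∨ m = -1 then 1 else 0)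
  else ((Finset.univ.filter (fun p : n.Partition => crank p = m)).card : ℤ)

/-- Number of partitions of the integer `N` whose Frobenius symbol has no entry `j` in its top row;
a negative integer has no partitions. -/
def numFrobeniusTopAvoiding (j : ℕ) : ℤ → ℕ
  | Int.ofNat k => (Finset.univ.filter (fun p : k.Partition => j ∉ frobeniusTop p)).card
  | Int.negSucc _ => 0

/-- For fixed `n` only finitely many `M(m, n)` are nonzero, so sums over `m` are finite sums. -/
theorem crankM_support_finite (n : ℕ) : (Function.support fun m : ℤ => crankM m n).Finite := by
  refine Set.Finite.subset
    ((Set.toFinite ({0, 1, -1} : Set ℤ)).union (Set.finite_range (crank (n := n)))) ?_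
  intro m hm
  by_contra hc
  apply hm
  simp only [Set.mem_union, Set.mem_insert_iff, Set.mem_singleton_iff, Set.mem_range, not_or,
    not_exists] at hc
  obtain ⟨⟨h0, h1, h2⟩, h3⟩ := hc
  simp [crankM, h0, h1, h2, h3]

end CrankFrobenius

namespace CrankFrobenius

/-! Both counts equal the number of profiles `f` of `n` with `f w = w + j` for some `w`. Partitions
correspond to profiles through their rows and through their columns, so each statistic can be read
off in the more convenient way.

Frobenius side, in rows: an entry `j` means `f i = i + 1 + j` for some `i`. If `f w = w + j`,
deleting that row and lengthening the `w` rows before it by one lowers the size by `j`; the result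
avoids the entry `j`, and the step is reversible (`profileCount_exists_eq`).

Crank side, in columns: ω = `f 0 - f 1` and μ = `f ω`. For `w ≥ 1` let A_w count the profiles with ω
≥ w and `f w ≥ w + j`, let C_w count those among them with ω = w (crank at least `j`), and for `w ≥
0` let E_w count the profiles with `f (w + 1) ≤ w + j < f w`. Exchanging ones for a part `w + 1`
gives A_w = C_w + A_{w+1} + E_w (`profileCount_numOnes_step`). Hence ω > 0 contributes A_1 minus all
E_w with `w ≥ 1`. By conjugation, ω = 0 contributes the number of `f` with `j ≤ f 0`, minus A_1 +
E_0; only this step fails at `(n, j) = (1, 1)`. In total A_1 cancels, and what is left is the number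
of `f` with `j ≤ f 0` that do not jump across the line `w + j`, so they meet it
(`profileCount_le_apply_zero`). -/

/-- A function is a profile of `n` if it is antitone with finite support and total sum `n`. -/
def IsProfile (n : ℕ) (f : ℕ → ℕ) : Prop :=
  Antitone f ∧ ∃ N, ∀ M, N ≤ M → ∑ i ∈ Finset.range M, f i = n

/-- The number of profiles of `n` with the property `P`. -/
noncomputable def profileCount (n : ℕ) (P : (ℕ → ℕ) → Prop) : ℕ :=
  Set.ncard {f | IsProfile n f ∧ P f}

theorem IsProfile.mul_le {n : ℕ} {f : ℕ → ℕ} (h : IsProfile n f) (i : ℕ) :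
    (i + 1) * f i ≤ n := by
  obtain ⟨hf, N, hN⟩ := h
  rw [← hN (max N (i + 1)) (le_max_left _ _)]
  calc (i + 1) * f i = ∑ k ∈ Finset.range (i + 1), f i := by simp
    _ ≤ ∑ k ∈ Finset.range (i + 1), f k :=
        Finset.sum_le_sum fun k hk => hf (by have := Finset.mem_range.1 hk; omega)
    _ ≤ _ := Finset.sum_le_sum_of_subset (Finset.range_mono (le_max_right _ _))

theorem IsProfile.apply_le {n : ℕ} {f : ℕ → ℕ} (h : IsProfile n f) (i : ℕ) : f i ≤ n :=
  (Nat.le_mul_of_pos_left _ (Nat.succ_pos i)).trans (h.mul_le i)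

theorem IsProfile.eq_zero {n : ℕ} {f : ℕ → ℕ} (h : IsProfile n f) {i : ℕ} (hi : n ≤ i) :
    f i = 0 := by
  have := h.mul_le i
  by_contra h0
  have : (i + 1) * 1 ≤ (i + 1) * f i := Nat.mul_le_mul_left _ (Nat.pos_of_ne_zero h0)
  omega

/-! ### Column lengths -/

/-- The column lengths of the Ferrers diagram: the number of parts greater than `i`. -/
def colFun {n : ℕ} (p : n.Partition) (i : ℕ) : ℕ := p.parts.countP (fun a => i < a)

theorem sum_countP_lt (s : Multiset ℕ) (M : ℕ) (h : ∀ a ∈ s, a ≤ M) :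
    ∑ i ∈ Finset.range M, s.countP (fun a => i < a) = s.sum := by
  induction s using Multiset.induction with
  | empty => simp
  | cons a s ih =>
    simp only [Multiset.countP_cons, Finset.sum_add_distrib, Multiset.sum_cons]
    rw [ih fun b hb => h b (Multiset.mem_cons_of_mem hb), ← Finset.card_filter, add_comm]
    have ha := h a (Multiset.mem_cons_self a s)
    have : (Finset.range M).filter (fun i => i < a) = Finset.range a := by
      ext i; simp; omega
    rw [this, Finset.card_range]

theorem isProfile_colFun {n : ℕ} (p : n.Partition) : IsProfile n (colFun p) := by
  refine ⟨antitone_nat_of_succ_le fun i => ?_, n, fun M hM => ?_⟩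
  · rw [colFun, colFun, Multiset.countP_eq_card_filter, Multiset.countP_eq_card_filter]
    exact Multiset.card_le_card (Multiset.monotone_filter_right _ fun a ha => by omega)
  · conv_rhs => rw [← p.parts_sum]
    exact sum_countP_lt _ _ fun a ha =>
      ((Multiset.le_sum_of_mem ha).trans_eq p.parts_sum).trans hM

theorem count_succ_add_countP (s : Multiset ℕ) (k : ℕ) :
    s.count (k + 1) + s.countP (fun a => k + 1 < a) = s.countP (fun a => k < a) := by
  induction s using Multiset.induction with
  | empty => simp
  | cons a s ih =>
    simp only [Multiset.countP_cons, Multiset.count_cons]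
    split_ifs <;> omega

theorem colFun_injective (n : ℕ) : Function.Injective (colFun (n := n)) := by
  intro p q h
  ext k
  cases k with
  | zero =>
    rw [Multiset.count_eq_zero_of_notMem fun h0 => absurd (p.parts_pos h0) (lt_irrefl 0),
      Multiset.count_eq_zero_of_notMem fun h0 => absurd (q.parts_pos h0) (lt_irrefl 0)]
  | succ k =>
    have hp := count_succ_add_countP p.parts k
    have hq := count_succ_add_countP q.parts k
    have h1 := congrFun h k
    have h2 := congrFun h (k + 1)
    simp only [colFun] at h1 h2
    omega

/-- In a partition with column lengths `f`, the part `i + 1` occurs `f i - f (i + 1)` times; the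
count telescopes. -/
theorem countP_sum_replicate {f : ℕ → ℕ} (hf : Antitone f) (k N : ℕ) :
    (∑ i ∈ Finset.range N, Multiset.replicate (f i - f (i + 1)) (i + 1)).countP
      (fun a => k < a) = f k - f (max k N) := by
  induction N with
  | zero => simp
  | succ N ih =>
    rw [Finset.sum_range_succ, Multiset.countP_add, ih, Multiset.countP_eq_card_filter]
    have h1 := hf (Nat.le_succ N)
    rcases le_or_gt k N with h | h
    · have h2 := hf h
      rw [Multiset.filter_eq_self.2 fun a ha => by rw [Multiset.eq_of_mem_replicate ha]; omega,
        Multiset.card_replicate, max_eq_right h, max_eq_right (by omega)]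
      simp only [Nat.succ_eq_add_one] at *
      omega
    · rw [Multiset.filter_eq_nil.2 fun a ha => by rw [Multiset.eq_of_mem_replicate ha]; omega,
        Multiset.card_zero, max_eq_left h.le, max_eq_left (by omega), add_zero]

theorem exists_colFun_eq {n : ℕ} {f : ℕ → ℕ} (h : IsProfile n f) :
    ∃ p : n.Partition, colFun p = f := by
  set s := ∑ i ∈ Finset.range n, Multiset.replicate (f i - f (i + 1)) (i + 1) with hs
  have hmem : ∀ a ∈ s, 0 < a ∧ a ≤ n := by
    intro a ha
    rw [hs, Multiset.mem_sum] at ha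
    obtain ⟨i, hi, ha⟩ := ha
    rw [Multiset.eq_of_mem_replicate ha]
    have := Finset.mem_range.1 hi
    omega
  have hc : ∀ k, s.countP (fun a => k < a) = f k := fun k => by
    rw [hs, countP_sum_replicate h.1, h.eq_zero (le_max_right k n), Nat.sub_zero]
  obtain ⟨N, hN⟩ := h.2
  refine ⟨⟨s, fun {a} ha => (hmem a ha).1, ?_⟩, funext hc⟩
  rw [← hN (max n N) (le_max_right _ _),
    ← sum_countP_lt s (max n N) fun a ha => (hmem a ha).2.trans (le_max_left _ _)]
  exact Finset.sum_congr rfl fun k _ => hc k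

theorem finite_isProfile (n : ℕ) : {f | IsProfile n f}.Finite :=
  (Set.finite_range (colFun (n := n))).subset fun _ h => exists_colFun_eq h

theorem card_filter_colFun (n : ℕ) (P : (ℕ → ℕ) → Prop)
    [DecidablePred fun p : n.Partition => P (colFun p)] :
    (Finset.univ.filter fun p : n.Partition => P (colFun p)).card = profileCount n P := by
  classical
  rw [profileCount, ← Finset.card_image_of_injective _ (colFun_injective n),
    ← Set.ncard_coe_finset]
  congr 1
  ext f
  simp only [Finset.coe_image, Finset.coe_filter, Finset.mem_univ, true_and, Set.mem_image,
    Set.mem_ofPred_eq]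
  constructor
  · rintro ⟨p, hp, rfl⟩
    exact ⟨isProfile_colFun p, hp⟩
  · rintro ⟨h, hP⟩
    obtain ⟨p, rfl⟩ := exists_colFun_eq h
    exact ⟨p, hP, rfl⟩

/-! ### Row lengths -/

/-- The row lengths of the Ferrers diagram: the `i`-th largest part, or `0`. -/
def rowFun {n : ℕ} (p : n.Partition) (i : ℕ) : ℕ := (p.parts.sort (· ≥ ·)).getD i 0

/-- Both sides say that the box `(i, k)` lies in the diagram. -/
theorem lt_getD_iff {l : List ℕ} (hl : l.Pairwise (· ≥ ·)) (i k : ℕ) :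
    k < l.getD i 0 ↔ i < l.countP (fun a => k < a) := by
  induction l generalizing i with
  | nil => simp
  | cons a t ih =>
    rw [List.pairwise_cons] at hl
    rw [List.countP_cons]
    by_cases hk : k < a
    · cases i with
      | zero => simp [hk]
      | succ i => simp [hk, ← ih hl.2]
    · have h0 : t.countP (fun a => k < a) = 0 := by
        rw [List.countP_eq_zero]
        intro b hb
        have := hl.1 b hb
        simp; omega
      cases i with
      | zero => simp [hk, h0]
      | succ i =>
        have := ih hl.2 i
        rw [h0] at this
        simpa [hk, h0] using this

theorem lt_rowFun_iff {n : ℕ} (p : n.Partition) (i k : ℕ) :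
    k < rowFun p i ↔ i < colFun p k := by
  rw [rowFun, lt_getD_iff (p.parts.pairwise_sort _), colFun]
  conv_rhs => rw [← Multiset.sort_eq p.parts (· ≥ ·), Multiset.coe_countP]

theorem sum_getD (l : List ℕ) (M : ℕ) (h : l.length ≤ M) :
    ∑ i ∈ Finset.range M, l.getD i 0 = l.sum := by
  induction l generalizing M with
  | nil => simp
  | cons a t ih =>
    cases M with
    | zero => simp at h
    | succ M =>
      rw [Finset.sum_range_succ', List.sum_cons, ← ih M (by simpa using h), add_comm]
      simp

theorem isProfile_rowFun {n : ℕ} (p : n.Partition) : IsProfile n (rowFun p) := by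
  refine ⟨fun a b hab => ?_, _, fun M hM => (sum_getD _ M hM).trans ?_⟩
  · refine le_of_forall_lt fun k hk => ?_
    rw [lt_rowFun_iff] at hk ⊢
    omega
  · rw [← Multiset.sum_coe, Multiset.sort_eq, p.parts_sum]

theorem rowFun_injective (n : ℕ) : Function.Injective (rowFun (n := n)) := by
  intro p q h
  refine colFun_injective n (funext fun k => eq_of_forall_lt_iff fun i => ?_)
  rw [← lt_rowFun_iff, ← lt_rowFun_iff, h]

theorem card_filter_rowFun (n : ℕ) (P : (ℕ → ℕ) → Prop)
    [DecidablePred fun p : n.Partition => P (rowFun p)] :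
    (Finset.univ.filter fun p : n.Partition => P (rowFun p)).card = profileCount n P := by
  classical
  -- Conjugation: an injective self-map of a finite type, hence a bijection that turns rows into
  -- columns.
  choose conj hconj using fun p : n.Partition => exists_colFun_eq (isProfile_rowFun p)
  have hinj : Function.Injective conj := fun p q h =>
    rowFun_injective n (by rw [← hconj p, ← hconj q, h])
  have hbij := Finite.injective_iff_bijective.1 hinj
  rw [← card_filter_colFun]
  refine Finset.card_bijective conj hbij fun p => ?_
  simp [hconj]

/-! ### Translating the statistics -/

theorem numOnes_add_colFun_one {n : ℕ} (p : n.Partition) :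
    numOnes p + colFun p 1 = colFun p 0 := count_succ_add_countP p.parts 0

theorem le_sup_parts_iff {n : ℕ} (p : n.Partition) (j : ℕ) :
    j ≤ p.parts.sup ↔ ∀ k < j, 0 < colFun p k := by
  constructor
  · intro h k hk
    rw [colFun, Multiset.countP_pos]
    by_contra! hc
    have := Multiset.sup_le.2 hc
    omega
  · intro h
    cases j with
    | zero => exact Nat.zero_le _
    | succ j =>
      have := h j (Nat.lt_succ_self j)
      rw [colFun, Multiset.countP_pos] at this
      obtain ⟨a, ha, hj⟩ := this
      exact le_trans hj (Multiset.le_sup ha)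

theorem le_crank_iff {n : ℕ} (p : n.Partition) (j : ℕ) :
    (j : ℤ) ≤ crank p ↔
      (colFun p 0 = colFun p 1 ∧ ∀ k < j, 0 < colFun p k) ∨
      (colFun p 1 < colFun p 0 ∧
        colFun p 0 - colFun p 1 + j ≤ colFun p (colFun p 0 - colFun p 1)) := by
  have h := numOnes_add_colFun_one p
  have h1 : colFun p 0 - colFun p 1 = numOnes p := by omega
  have h2 : numLarge p = colFun p (numOnes p) := rfl
  rw [crank, h1, ← le_sup_parts_iff, h2]
  split_ifs with h0
  · constructor
    · intro h3; left; omega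
    · rintro (h3 | h3) <;> omega
  · constructor
    · intro h3; right; omega
    · rintro (h3 | h3) <;> omega

theorem mem_ferrers_iff {n : ℕ} (p : n.Partition) (i k : ℕ) :
    (i, k) ∈ (ferrers p).cells ↔ k < rowFun p i := by
  rw [YoungDiagram.mem_cells, ferrers, YoungDiagram.mem_ofRowLens, rowFun]
  by_cases h : i < (p.parts.sort (· ≥ ·)).length
  · rw [List.getD_eq_getElem _ _ h]
    exact ⟨fun ⟨_, hk⟩ => hk, fun hk => ⟨h, hk⟩⟩
  · rw [List.getD_eq_default _ _ (by omega)]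
    simp at h
    simp [h]

theorem notMem_frobeniusTop_iff {n : ℕ} (p : n.Partition) (j : ℕ) :
    j ∉ frobeniusTop p ↔ ∀ i, rowFun p i ≠ i + 1 + j := by
  have harm : ∀ i, ((ferrers p).cells.filter (fun c => c.1 = i ∧ i < c.2)).card
      = rowFun p i - (i + 1) := by
    intro i
    rw [← Nat.card_Ico (i + 1) (rowFun p i)]
    refine Eq.trans ?_ (Finset.card_map ⟨fun k => (i, k), Prod.mk_right_injective i⟩)
    congr 1
    ext ⟨a, b⟩
    simp only [Finset.mem_filter, mem_ferrers_iff, Finset.mem_map, Finset.mem_Ico,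
      Function.Embedding.coeFn_mk, Prod.mk.injEq]
    constructor
    · rintro ⟨h1, rfl, h2⟩
      exact ⟨b, ⟨h2, h1⟩, rfl, rfl⟩
    · rintro ⟨k, ⟨h1, h2⟩, rfl, rfl⟩
      exact ⟨h2, rfl, h1⟩
  have hanti := (isProfile_rowFun p).1
  have hdiag : ∀ i, i < diagLen (ferrers p) ↔ i < rowFun p i := by
    obtain ⟨d, hd⟩ : ∃ d, ∀ i, i < rowFun p i ↔ i < d := by
      have hex : ∃ d, rowFun p d ≤ d := ⟨n, by rw [(isProfile_rowFun p).eq_zero le_rfl]; omega⟩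
      classical
      refine ⟨Nat.find hex, fun i => ?_⟩
      constructor
      · intro hi
        by_contra! hc
        have := Nat.find_spec hex
        have := hanti hc
        omega
      · intro hi
        have := Nat.find_min hex hi
        omega
    have : diagLen (ferrers p) = d := by
      rw [diagLen, ← Finset.card_range d]
      refine Eq.trans ?_
        (Finset.card_map ⟨fun k : ℕ => (k, k), fun a b h => (Prod.mk.inj h).1⟩)
      congr 1
      ext ⟨a, b⟩
      simp only [Finset.mem_filter, mem_ferrers_iff, Finset.mem_map, Finset.mem_range]
      constructor
      · rintro ⟨h1, rfl⟩
        exact ⟨a, (hd a).1 h1, rfl⟩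
      · rintro ⟨k, h1, h2⟩
        obtain ⟨rfl, rfl⟩ := Prod.mk.inj h2
        exact ⟨(hd k).2 h1, rfl⟩
    intro i
    rw [this, hd]
  simp only [frobeniusTop, List.mem_map, List.mem_range, not_exists, not_and, harm, hdiag]
  -- A row with `rowFun p i ≤ i` has no diagonal box, and it cannot have length `i + 1 + j` either.
  exact forall_congr' fun i => by omega

theorem card_notMem_frobeniusTop (n j : ℕ) :
    (Finset.univ.filter fun p : n.Partition => j ∉ frobeniusTop p).card
      = profileCount n fun f => ∀ i, f i ≠ i + 1 + j := by
  classical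
  rw [← card_filter_rowFun]
  congr 1
  ext p
  simp only [Finset.mem_filter, Finset.mem_univ, true_and, notMem_frobeniusTop_iff]

/-! ### Counting profiles -/

theorem profileCount_congr {n : ℕ} {P Q : (ℕ → ℕ) → Prop}
    (h : ∀ f, IsProfile n f → (P f ↔ Q f)) : profileCount n P = profileCount n Q := by
  rw [profileCount, profileCount]
  congr 1
  ext f
  exact and_congr_right (h f)

theorem profileCount_eq_zero {n : ℕ} {P : (ℕ → ℕ) → Prop}
    (h : ∀ f, IsProfile n f → ¬ P f) : profileCount n P = 0 := by
  rw [profileCount, Set.ncard_eq_zero ((finite_isProfile n).subset fun _ hf => hf.1)]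
  exact Set.eq_empty_of_forall_notMem fun f hf => h f hf.1 hf.2

theorem profileCount_add {n : ℕ} {P Q R : (ℕ → ℕ) → Prop}
    (h : ∀ f, IsProfile n f → (R f ↔ P f ∨ Q f)) (hd : ∀ f, IsProfile n f → P f → ¬ Q f) :
    profileCount n R = profileCount n P + profileCount n Q := by
  rw [profileCount_congr h, profileCount, profileCount, profileCount,
    ← Set.ncard_union_eq (Set.disjoint_left.2 fun f hf hg => hd f hf.1 hf.2 hg.2)
      ((finite_isProfile n).subset fun _ hf => hf.1)
      ((finite_isProfile n).subset fun _ hf => hf.1)]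
  congr 1
  ext f
  simp only [Set.mem_ofPred_eq, Set.mem_union]
  tauto

theorem profileCount_eq_of_inverse {m n : ℕ} {P Q : (ℕ → ℕ) → Prop}
    (F G : (ℕ → ℕ) → ℕ → ℕ)
    (hF : ∀ f, IsProfile m f → P f → IsProfile n (F f) ∧ Q (F f) ∧ G (F f) = f)
    (hG : ∀ g, IsProfile n g → Q g → IsProfile m (G g) ∧ P (G g) ∧ F (G g) = g) :
    profileCount m P = profileCount n Q := by
  refine Set.ncard_congr (fun f _ => F f) (fun f hf => ?_) (fun f g hf hg h => ?_)
    (fun g hg => ?_)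
  · obtain ⟨h1, h2, -⟩ := hF f hf.1 hf.2
    exact ⟨h1, h2⟩
  · rw [← (hF f hf.1 hf.2).2.2, ← (hF g hg.1 hg.2).2.2]
    exact congrArg G h
  · obtain ⟨h1, h2, h3⟩ := hG g hg.1 hg.2
    exact ⟨G g, ⟨h1, h2⟩, h3⟩

theorem profileCount_forall_pos (n j : ℕ) :
    profileCount n (fun f => ∀ k < j, 0 < f k) = profileCount n fun f => j ≤ f 0 := by
  classical
  rw [← card_filter_colFun, ← card_filter_rowFun]
  congr 1
  ext p
  simp only [Finset.mem_filter, Finset.mem_univ, true_and, ← lt_rowFun_iff]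
  exact ⟨fun h => le_of_forall_lt h, fun h k hk => hk.trans_le h⟩

/-! ### Adding and removing `t` parts equal to `k + 1` -/

theorem sum_add_indicator (f : ℕ → ℕ) (k t M : ℕ) (hM : k + 1 ≤ M) :
    ∑ i ∈ Finset.range M, (if i ≤ k then f i + t else f i)
      = ∑ i ∈ Finset.range M, f i + (k + 1) * t := by
  have h : ∀ i, (if i ≤ k then f i + t else f i) = f i + if i ≤ k then t else 0 := fun i => by
    split_ifs <;> rfl
  have h2 : (Finset.range M).filter (fun i => i ≤ k) = Finset.range (k + 1) := by
    ext i; simp; omega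
  simp only [h, Finset.sum_add_distrib]
  rw [← Finset.sum_filter, h2]
  simp

/-- Remove `t` parts equal to `k + 1`, in terms of column lengths. -/
def removeParts (k t : ℕ) (f : ℕ → ℕ) (i : ℕ) : ℕ := if i ≤ k then f i - t else f i

/-- A part `k + 1` adds one box to each of the columns `0, …, k`, so `f (k + 1) + t ≤ f k` says that
at least `t` such parts are present. -/
theorem profileCount_removeParts (m k t : ℕ) (P : (ℕ → ℕ) → Prop) :
    profileCount m P = profileCount (m + (k + 1) * t)
      fun f => f (k + 1) + t ≤ f k ∧ P (removeParts k t f) := by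
  have hinv : ∀ f, removeParts k t (fun i => if i ≤ k then f i + t else f i) = f := by
    intro f
    funext i
    simp only [removeParts]
    split_ifs <;> omega
  refine profileCount_eq_of_inverse (fun f i => if i ≤ k then f i + t else f i)
    (removeParts k t) (fun f hf hP => ⟨⟨?_, ?_⟩, ⟨?_, ?_⟩, hinv f⟩)
    (fun g hg hQ => ?_)
  · refine antitone_nat_of_succ_le fun i => ?_
    have := hf.1 (Nat.le_succ i)
    simp only [Nat.succ_eq_add_one] at this ⊢
    split_ifs <;> omega
  · obtain ⟨N, hN⟩ := hf.2
    refine ⟨max N (k + 1), fun M hM => ?_⟩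
    rw [sum_add_indicator f k t M (by omega), hN M (by omega)]
  · have := hf.1 (Nat.le_succ k)
    simp only [Nat.succ_eq_add_one] at this
    simp [this]
  · rw [hinv]; exact hP
  · have hle : ∀ i ≤ k, t ≤ g i := fun i hi => by
      have := hg.1 hi
      omega
    have hinv' : (fun i => if i ≤ k then removeParts k t g i + t else removeParts k t g i) = g := by
      funext i
      simp only [removeParts]
      split_ifs with h
      · have := hle i h
        omega
      · rfl
    refine ⟨⟨?_, ?_⟩, hQ.2, hinv'⟩
    · refine antitone_nat_of_succ_le fun i => ?_
      have h1 := hg.1 (Nat.le_succ i)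
      have h2 := hQ.1
      simp only [Nat.succ_eq_add_one, removeParts] at h1 ⊢
      rcases eq_or_ne i k with rfl | hne
      · simp; omega
      · split_ifs <;> omega
    · obtain ⟨N, hN⟩ := hg.2
      refine ⟨max N (k + 1), fun M hM => ?_⟩
      have h1 := sum_add_indicator (removeParts k t g) k t M (by omega)
      rw [hinv', hN M (by omega)] at h1
      omega

/-! ### The telescoping recursion -/

/-- Split by whether `f (w + 1)` exceeds `w + j`. If so, add `w + 1` ones, which changes column `0`
only; if not, add one part `w + 1`, which raises `f w` and makes its inequality strict. -/
theorem profileCount_level (m j w : ℕ) :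
    profileCount m (fun f => w + j ≤ f w) =
      profileCount (m + (w + 1)) (fun f => f 1 + (w + 1) ≤ f 0 ∧ w + 1 + j ≤ f (w + 1)) +
      profileCount (m + (w + 1)) (fun f => f (w + 1) ≤ w + j ∧ w + j < f w) := by
  rw [profileCount_add (P := fun f => w + 1 + j ≤ f (w + 1))
    (Q := fun f => w + j ≤ f w ∧ f (w + 1) ≤ w + j)]
  · congr 1
    · rw [profileCount_removeParts m 0 (w + 1), zero_add, one_mul]
      simp [removeParts]
    · rw [profileCount_removeParts m w 1, mul_one]
      refine profileCount_congr fun f _ => ?_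
      simp [removeParts]
      omega
  · intro f hf
    have := hf.1 (Nat.le_succ w)
    simp only [Nat.succ_eq_add_one] at this
    omega
  · intro f hf
    omega

/-- Separate exactly `w` ones from more. In the second case strip `w + 1` ones, which leaves `f w`
alone because `w ≥ 1`, and apply `profileCount_level`. -/
theorem profileCount_numOnes_step (n j w : ℕ) (hw : 1 ≤ w) :
    profileCount n (fun f => f 1 + w ≤ f 0 ∧ w + j ≤ f w) =
      profileCount n (fun f => f 1 + w = f 0 ∧ w + j ≤ f w) +
      (profileCount n (fun f => f 1 + (w + 1) ≤ f 0 ∧ w + 1 + j ≤ f (w + 1)) +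
      profileCount n (fun f => f (w + 1) ≤ w + j ∧ w + j < f w)) := by
  rw [profileCount_add (P := fun f => f 1 + w = f 0 ∧ w + j ≤ f w)
    (Q := fun f => f 1 + (w + 1) ≤ f 0 ∧ w + j ≤ f w) (fun f _ => by omega)
    (fun f _ => by omega)]
  congr 1
  rcases le_or_gt (w + 1) n with h | h
  · obtain ⟨m, rfl⟩ := Nat.exists_eq_add_of_le' h
    rw [← profileCount_level, profileCount_removeParts m 0 (w + 1), zero_add, one_mul]
    refine profileCount_congr fun f _ => ?_
    simp [removeParts, show w ≠ 0 by omega]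
  · rw [profileCount_eq_zero, profileCount_eq_zero, profileCount_eq_zero]
    · intro f hf
      have := hf.eq_zero (show n ≤ w by omega)
      omega
    · intro f hf
      have := hf.apply_le 0
      omega
    · intro f hf
      have := hf.apply_le 0
      omega

/-- An antitone `f` jumps across the increasing line `u + j` at most once, so the cases are
disjoint. -/
theorem profileCount_exists_ge_succ (n j w : ℕ) :
    profileCount n (fun f => ∃ u, w ≤ u ∧ f (u + 1) ≤ u + j ∧ u + j < f u) =
      profileCount n (fun f => f (w + 1) ≤ w + j ∧ w + j < f w) +
      profileCount n (fun f => ∃ u, w + 1 ≤ u ∧ f (u + 1) ≤ u + j ∧ u + j < f u) := by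
  refine profileCount_add (fun f _ => ?_) fun f hf h1 => ?_
  · constructor
    · rintro ⟨u, hu, h⟩
      rcases hu.eq_or_lt with rfl | hu
      · exact Or.inl h
      · exact Or.inr ⟨u, hu, h⟩
    · rintro (h | ⟨u, hu, h⟩)
      · exact ⟨w, le_rfl, h⟩
      · exact ⟨u, by omega, h⟩
  · rintro ⟨u, hu, h2⟩
    have := hf.1 hu
    omega

/-- The recursion summed from `w` upwards. The number `d` bounds the steps left: once `w > n`, every
count vanishes. -/
theorem profileCount_numOnes_tail (n j d w : ℕ) (hw : 1 ≤ w) (hd : n < w + d) :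
    profileCount n (fun f => f 1 + w ≤ f 0 ∧ w + j ≤ f w) =
      profileCount n (fun f => f 1 + w ≤ f 0 ∧ f 0 - f 1 + j ≤ f (f 0 - f 1)) +
      profileCount n (fun f => ∃ u, w ≤ u ∧ f (u + 1) ≤ u + j ∧ u + j < f u) := by
  induction d generalizing w with
  | zero =>
    rw [profileCount_eq_zero, profileCount_eq_zero, profileCount_eq_zero]
    · rintro f hf ⟨u, hu, h1, h2⟩
      have := hf.eq_zero (show n ≤ u by omega)
      omega
    · intro f hf
      have := hf.apply_le 0
      omega
    · intro f hf
      have := hf.apply_le 0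
      omega
  | succ d ih =>
    rw [profileCount_numOnes_step n j w hw, ih (w + 1) (by omega) (by omega)]
    have h1 : profileCount n (fun f => f 1 + w ≤ f 0 ∧ f 0 - f 1 + j ≤ f (f 0 - f 1)) =
        profileCount n (fun f => f 1 + w = f 0 ∧ w + j ≤ f w) +
        profileCount n (fun f => f 1 + (w + 1) ≤ f 0 ∧ f 0 - f 1 + j ≤ f (f 0 - f 1)) := by
      refine profileCount_add (fun f _ => ?_) (fun f _ => by omega)
      constructor
      · rintro ⟨h1, h2⟩
        rcases h1.eq_or_lt with h | h
        · rw [show f 0 - f 1 = w by omega] at h2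
          exact Or.inl ⟨h, h2⟩
        · exact Or.inr ⟨by omega, h2⟩
      · rintro (⟨h1, h2⟩ | ⟨h1, h2⟩)
        · rw [show f 0 - f 1 = w by omega]
          exact ⟨h1.le, h2⟩
        · exact ⟨by omega, h2⟩
    rw [h1, profileCount_exists_ge_succ n j w]
    omega

theorem profileCount_le_apply_zero (n j : ℕ) :
    profileCount n (fun f => j ≤ f 0) =
      profileCount n (fun f => ∃ w, f w = w + j) +
      profileCount n (fun f => ∃ u, 0 ≤ u ∧ f (u + 1) ≤ u + j ∧ u + j < f u) := by
  refine profileCount_add (fun f hf => ?_) fun f hf => ?_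
  · constructor
    · intro h
      have hex : ∃ w, f (w + 1) ≤ w + j := ⟨n, by rw [hf.eq_zero (Nat.le_succ n)]; omega⟩
      classical
      -- Minimality of `w` puts `f w` on or above the line: equality is a meeting point, strict
      -- inequality a jump.
      obtain ⟨w, hw, hmin⟩ : ∃ w, f (w + 1) ≤ w + j ∧ ∀ u < w, ¬ f (u + 1) ≤ u + j :=
        ⟨Nat.find hex, Nat.find_spec hex, fun u hu => Nat.find_min hex hu⟩
      have hge : w + j ≤ f w := by
        cases w with
        | zero => omega
        | succ w =>
          have := hmin w (Nat.lt_succ_self w)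
          omega
      rcases hge.eq_or_lt with h' | h'
      · exact Or.inl ⟨w, h'.symm⟩
      · exact Or.inr ⟨w, Nat.zero_le w, hw, h'⟩
    · rintro (⟨w, h⟩ | ⟨w, -, -, h⟩) <;>
      · have := hf.1 (Nat.zero_le w)
        omega
  · rintro ⟨w, hw⟩ ⟨u, -, h1, h2⟩
    rcases le_or_gt w u with h | h
    · have := hf.1 h
      omega
    · have := hf.1 (Nat.succ_le_of_lt h)
      simp only [Nat.succ_eq_add_one] at this
      omega

/-! ### The crank side -/

/-- Removing a single 1 keeps the largest part at least `j` unless that 1 was itself the largest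
part and `j = 1`; then the partition is `(1)`, the excluded case. -/
theorem profileCount_one_mem (n j : ℕ) (h : ¬ (n = 0 ∧ j = 1)) :
    profileCount (n + 1) (fun f => f 1 < f 0 ∧ ∀ k < j, 0 < f k) =
      profileCount n fun f => j ≤ f 0 := by
  rw [← profileCount_forall_pos, profileCount_removeParts n 0 1, zero_add, one_mul]
  refine profileCount_congr fun f hf => and_congr_right fun h1 => ?_
  simp only [removeParts]
  constructor
  · intro h2 k hk
    rcases Nat.eq_zero_or_pos k with rfl | hk0
    · simp only [le_refl, if_true]
      by_contra h0
      have hf1 : f 1 = 0 := by omega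
      have hj : j = 1 := by
        by_contra hj
        have := h2 1 (by omega)
        omega
      refine h ⟨?_, hj⟩
      obtain ⟨N, hN⟩ := hf.2
      have h3 := hN (N + 1) (by omega)
      rw [Finset.sum_range_succ', Finset.sum_eq_zero fun i _ => by
        have := hf.1 (show 1 ≤ i + 1 by omega)
        omega] at h3
      omega
    · rw [if_neg (by omega)]
      exact h2 k hk
  · intro h2 k hk
    have := h2 k hk
    split_ifs at this <;> omega

theorem numCrankGE_eq (n j : ℕ) (h : ¬ (n = 1 ∧ j = 1)) :
    numCrankGE j n = profileCount n fun f => ∃ w, f w = w + j := by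
  classical
  have hcard : numCrankGE j n =
      profileCount n (fun f => f 0 = f 1 ∧ ∀ k < j, 0 < f k) +
      profileCount n (fun f => f 1 + 1 ≤ f 0 ∧ f 0 - f 1 + j ≤ f (f 0 - f 1)) := by
    rw [← profileCount_add (R := fun f => (f 0 = f 1 ∧ ∀ k < j, 0 < f k) ∨
        (f 1 + 1 ≤ f 0 ∧ f 0 - f 1 + j ≤ f (f 0 - f 1))) (fun f _ => Iff.rfl)
        (fun f _ => by omega), ← card_filter_colFun, numCrankGE]
    congr 1
    ext p
    simp only [Finset.mem_filter, Finset.mem_univ, true_and, le_crank_iff, Nat.succ_le_iff]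
  have hsplit : profileCount n (fun f => ∀ k < j, 0 < f k) =
      profileCount n (fun f => f 0 = f 1 ∧ ∀ k < j, 0 < f k) +
      profileCount n (fun f => f 1 < f 0 ∧ ∀ k < j, 0 < f k) := by
    refine profileCount_add (fun f hf => ?_) (fun f _ => by omega)
    have := hf.1 (Nat.zero_le 1)
    rcases this.eq_or_lt with h | h
    · simp [h]
    · simp [h, h.ne']
  have htail := profileCount_numOnes_tail n j n 1 le_rfl (by omega)
  have hexists := profileCount_exists_ge_succ n j 0
  have hzero := profileCount_le_apply_zero n j
  rw [profileCount_forall_pos] at hsplit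
  have hones : profileCount n (fun f => f 1 < f 0 ∧ ∀ k < j, 0 < f k) =
      profileCount n (fun f => f 1 + 1 ≤ f 0 ∧ 1 + j ≤ f 1) +
      profileCount n (fun f => f (0 + 1) ≤ 0 + j ∧ 0 + j < f 0) := by
    cases n with
    | zero =>
      rw [profileCount_eq_zero, profileCount_eq_zero, profileCount_eq_zero] <;>
      · intro f hf
        have := hf.apply_le 0
        omega
    | succ n =>
      rw [profileCount_one_mem n j (by omega)]
      simpa using profileCount_level n j 0
  simp only [zero_add] at *
  -- Linear combination of the identities above; the count `f 1 + 1 ≤ f 0 ∧ 1 + j ≤ f 1` cancels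
  -- between `hones` and `htail`.
  omega

/-! ### The Frobenius side -/

/-- Delete the value at `w` and add one to the values before it. -/
def deleteAt (w : ℕ) (f : ℕ → ℕ) (i : ℕ) : ℕ := if i < w then f i + 1 else f (i + 1)

/-- Insert the value `v` at `w` and subtract one from the values before it. -/
def insertAt (w v : ℕ) (g : ℕ → ℕ) (i : ℕ) : ℕ :=
  if i < w then g i - 1 else if i = w then v else g (i - 1)

theorem sum_deleteAt (w : ℕ) (f : ℕ → ℕ) (M : ℕ) (hM : w ≤ M) :
    ∑ i ∈ Finset.range M, deleteAt w f i + f w = ∑ i ∈ Finset.range (M + 1), f i + w := by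
  induction M, hM using Nat.le_induction with
  | base =>
    rw [Finset.sum_range_succ, Finset.sum_congr rfl fun i hi =>
      show deleteAt w f i = f i + 1 from if_pos (Finset.mem_range.1 hi)]
    simp [Finset.sum_add_distrib]
    omega
  | succ M hM ih =>
    rw [Finset.sum_range_succ, Finset.sum_range_succ _ (M + 1),
      show deleteAt w f M = f (M + 1) from if_neg (by omega)]
    omega

theorem insertAt_deleteAt (w : ℕ) (f : ℕ → ℕ) : insertAt w (f w) (deleteAt w f) = f := by
  funext i
  simp only [insertAt, deleteAt]
  rcases lt_trichotomy i w with h | rfl | h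
  · simp [h]
  · simp
  · rw [if_neg (by omega), if_neg (by omega), if_neg (by omega), Nat.sub_add_cancel (by omega)]

theorem deleteAt_insertAt (w v : ℕ) (g : ℕ → ℕ) (hg : ∀ i < w, 0 < g i) :
    deleteAt w (insertAt w v g) = g := by
  funext i
  simp only [insertAt, deleteAt]
  by_cases h : i < w
  · have := hg i h
    simp only [h, if_true]
    omega
  · rw [if_neg h, if_neg (by omega), if_neg (by omega), Nat.add_sub_cancel]

/-- The first index `w` with `f w ≤ w + j`. -/
noncomputable def crossing (j : ℕ) (f : ℕ → ℕ) : ℕ := sInf {w | f w ≤ w + j}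

theorem crossing_eq {j : ℕ} {f : ℕ → ℕ} {w : ℕ} (hw : f w ≤ w + j)
    (h : ∀ i < w, i + j < f i) : crossing j f = w := by
  refine le_antisymm (Nat.sInf_le hw) ?_
  by_contra! hc
  have h1 : f (crossing j f) ≤ crossing j f + j :=
    Nat.sInf_mem (s := {w | f w ≤ w + j}) ⟨w, hw⟩
  have h2 := h _ hc
  omega

theorem IsProfile.crossing_spec {n : ℕ} {f : ℕ → ℕ} (hf : IsProfile n f) (j : ℕ) :
    f (crossing j f) ≤ crossing j f + j ∧ ∀ i < crossing j f, i + j < f i := by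
  constructor
  · exact Nat.sInf_mem (s := {w | f w ≤ w + j}) ⟨n, by
      change f n ≤ n + j
      rw [hf.eq_zero le_rfl]
      omega⟩
  · intro i hi
    have : ¬ f i ≤ i + j := Nat.notMem_of_lt_sInf (s := {w | f w ≤ w + j}) hi
    omega

/-- The position `w` need not be recorded: it is the `crossing` both before and after deletion.
Conversely, avoiding `i + 1 + j` strengthens `i + j < g i` to `i + 1 + j < g i` before the crossing,
so subtracting one there keeps the crossing in place. -/
theorem profileCount_exists_eq (m j : ℕ) :
    profileCount (m + j) (fun f => ∃ w, f w = w + j) =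
      profileCount m fun f => ∀ i, f i ≠ i + 1 + j := by
  refine profileCount_eq_of_inverse (fun f => deleteAt (crossing j f) f)
    (fun g => insertAt (crossing j g) (crossing j g + j) g) (fun f hf hP => ?_)
    (fun g hg hQ => ?_)
  · obtain ⟨w, hw⟩ := hP
    have hlt : ∀ i < w, i + j < f i := fun i hi => by
      have := hf.1 hi.le
      omega
    have hcr : crossing j f = w := crossing_eq hw.le hlt
    have hstep : ∀ i, f (i + 1) ≤ f i := fun i => hf.1 (Nat.le_succ i)
    have hcr' : crossing j (deleteAt w f) = w := by
      refine crossing_eq ?_ fun i hi => ?_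
      · have := hstep w
        simp only [deleteAt, lt_irrefl, if_false]
        omega
      · have := hlt i hi
        simp only [deleteAt, hi, if_true]
        omega
    simp only [hcr, hcr']
    refine ⟨⟨antitone_nat_of_succ_le fun i => ?_, ?_⟩, fun i => ?_, ?_⟩
    · have h1 := hstep i
      have h2 := hstep (i + 1)
      simp only [deleteAt]
      split_ifs <;> omega
    · obtain ⟨N, hN⟩ := hf.2
      refine ⟨max N w, fun M hM => ?_⟩
      have h1 := sum_deleteAt w f M (by omega)
      rw [hN (M + 1) (by omega)] at h1
      omega
    · simp only [deleteAt]
      split_ifs with h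
      · have := hlt i h
        omega
      · have := hf.1 (show w ≤ i + 1 by omega)
        omega
    · rw [← hw, insertAt_deleteAt]
  · obtain ⟨hw, hlt'⟩ := hg.crossing_spec j
    set w := crossing j g
    have hlt : ∀ i < w, i + 1 + j < g i := fun i hi => by
      have h1 := hlt' i hi
      have h2 := hQ i
      omega
    have hcr : crossing j (insertAt w (w + j) g) = w := by
      refine crossing_eq (by simp [insertAt]) fun i hi => ?_
      have := hlt i hi
      simp only [insertAt, hi, if_true]
      omega
    have hinv := deleteAt_insertAt w (w + j) g fun i hi => by have := hlt i hi; omega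
    have hval : insertAt w (w + j) g w = w + j := by simp [insertAt]
    simp only [hcr]
    refine ⟨⟨antitone_nat_of_succ_le fun i => ?_, ?_⟩, ⟨w, hval⟩, hinv⟩
    · simp only [insertAt]
      rcases lt_trichotomy (i + 1) w with h | h | h
      · have : g (i + 1) ≤ g i := hg.1 (Nat.le_succ i)
        rw [if_pos h, if_pos (by omega)]
        omega
      · have := hlt i (by omega)
        rw [if_neg (by omega), if_pos h, if_pos (by omega)]
        omega
      · rw [if_neg (by omega), if_neg (by omega), if_neg (by omega), Nat.add_sub_cancel]
        split_ifs with h1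
        · rw [h1]; exact hw
        · exact hg.1 (Nat.sub_le i 1)
    · obtain ⟨N, hN⟩ := hg.2
      refine ⟨max N w + 1, fun M hM => ?_⟩
      obtain ⟨M, rfl⟩ : ∃ M', M = M' + 1 := ⟨M - 1, by omega⟩
      have h1 := sum_deleteAt w (insertAt w (w + j) g) M (by omega)
      rw [hinv, hN M (by omega), hval] at h1
      omega

theorem numFrobeniusTopAvoiding_natCast (j m : ℕ) :
    numFrobeniusTopAvoiding j (m : ℤ) = profileCount m fun f => ∀ i, f i ≠ i + 1 + j :=
  card_notMem_frobeniusTop m j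

theorem profileCount_eq_numFrobeniusTopAvoiding (n j : ℕ) :
    profileCount n (fun f => ∃ w, f w = w + j) =
      numFrobeniusTopAvoiding j ((n : ℤ) - (j : ℤ)) := by
  rcases le_or_gt j n with h | h
  · obtain ⟨m, rfl⟩ := Nat.exists_eq_add_of_le' h
    rw [profileCount_exists_eq, ← numFrobeniusTopAvoiding_natCast]
    congr 1
    push_cast
    ring
  · obtain ⟨d, rfl⟩ := Nat.exists_eq_add_of_lt h
    rw [show (n : ℤ) - ((n + d + 1 : ℕ) : ℤ) = Int.negSucc d by
      rw [Int.negSucc_eq]; push_cast; ring]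
    refine profileCount_eq_zero ?_
    rintro f hf ⟨w, hw⟩
    have := hf.apply_le w
    omega

theorem numCrankGE_eq_numFrobeniusTopAvoiding (n j : ℕ) (h : ¬ (n = 1 ∧ j = 1)) :
    numCrankGE j n = numFrobeniusTopAvoiding j ((n : ℤ) - (j : ℤ)) := by
  rw [numCrankGE_eq n j h, profileCount_eq_numFrobeniusTopAvoiding]

/-! ### The crank numbers -/

/-- Here no conventional value enters, and the sum groups the partitions by crank. -/
theorem finsum_crankM_of_two_le (n j : ℕ) (hn : 2 ≤ n) :
    (∑ᶠ (m : ℤ) (_ : (j : ℤ) ≤ m), crankM m n) = (numCrankGE j n : ℤ) := by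
  classical
  have hM : ∀ m, crankM m n =
      ((Finset.univ.filter (fun p : n.Partition => crank p = m)).card : ℤ) := fun m => by
    rw [crankM, if_neg (by omega), if_neg (by omega)]
  set t := (Finset.univ.filter (fun p : n.Partition => (j : ℤ) ≤ crank p)).image crank with ht
  change (∑ᶠ m ∈ Set.Ici (j : ℤ), crankM m n) = _
  rw [finsum_mem_eq_sum_of_inter_support_eq (t := t)]
  · rw [numCrankGE, Finset.card_eq_sum_card_image crank, Nat.cast_sum]
    refine Finset.sum_congr rfl fun m hm => ?_
    rw [hM, Finset.filter_filter]
    congr 2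
    ext p
    simp only [Finset.mem_filter, Finset.mem_univ, true_and]
    obtain ⟨q, hq, rfl⟩ := Finset.mem_image.1 hm
    have := (Finset.mem_filter.1 hq).2
    constructor
    · intro h
      exact ⟨h ▸ this, h⟩
    · exact fun h => h.2
  · ext m
    simp only [Set.mem_inter_iff, Set.mem_Ici, Function.mem_support, Finset.mem_coe]
    refine and_congr_left fun h => ?_
    rw [hM, Nat.cast_ne_zero, Finset.card_ne_zero] at h
    obtain ⟨p, hp⟩ := h
    have hp := (Finset.mem_filter.1 hp).2
    rw [ht, Finset.mem_image]
    constructor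
    · intro hm
      exact ⟨p, by simp [hp, hm], hp⟩
    · rintro ⟨q, hq, rfl⟩
      exact (Finset.mem_filter.1 hq).2

theorem finsum_crankM_zero (j : ℕ) :
    (∑ᶠ (m : ℤ) (_ : (j : ℤ) ≤ m), crankM m 0) = (numCrankGE j 0 : ℤ) := by
  have h1 : (∑ᶠ (m : ℤ) (_ : (j : ℤ) ≤ m), crankM m 0) = if j = 0 then 1 else 0 := by
    change (∑ᶠ m ∈ Set.Ici (j : ℤ), crankM m 0) = _
    rw [finsum_mem_eq_sum_of_inter_support_eq (t := if j = 0 then {0} else ∅)]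
    · split_ifs <;> simp [crankM]
    · ext m
      split_ifs <;> simp [crankM] <;> omega
  have h2 : ∀ p : Nat.Partition 0, crank p = 0 := fun p => by
    rw [Subsingleton.elim p default]
    rfl
  rw [h1, numCrankGE]
  simp only [h2]
  split_ifs with hj
  · simp [hj]
  · rw [Finset.filter_false_of_mem fun p _ => by omega]
    rfl

theorem finsum_crankM_one (j : ℕ) :
    (∑ᶠ (m : ℤ) (_ : (j : ℤ) ≤ m), crankM m 1) = if j = 1 then 1 else 0 := by
  change (∑ᶠ m ∈ Set.Ici (j : ℤ), crankM m 1) = _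
  rw [finsum_mem_eq_sum_of_inter_support_eq
    (t := if j = 0 then {0, 1} else if j = 1 then {1} else ∅)]
  · split_ifs <;> simp [crankM] <;> omega
  · ext m
    simp only [Set.mem_inter_iff, Set.mem_Ici, Function.mem_support, Finset.mem_coe]
    refine and_congr_left fun h => ?_
    have hm : m = 0 ∨ m = 1 ∨ m = -1 := by
      by_contra! hc
      simp [crankM, hc.1, hc.2.1, hc.2.2] at h
    split_ifs <;> simp <;> omega

theorem numCrankGE_one (j : ℕ) : numCrankGE j 1 = 0 := by
  have h : ∀ p : Nat.Partition 1, crank p = -1 := fun p => by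
    rw [Subsingleton.elim p (Nat.Partition.indiscrete 1)]
    decide
  rw [numCrankGE, Finset.filter_false_of_mem fun p _ => by rw [h]; omega]
  rfl

/-- The only partition of 1 has crank `-1`, so `numCrankGE j 1 = 0`. The conventional values agree
with this except at `j = 1`, where they give 1, matching the empty partition, which avoids every
entry. -/
theorem finsum_crankM_eq (n j : ℕ) :
    (∑ᶠ (m : ℤ) (_ : (j : ℤ) ≤ m), crankM m n) =
      (numFrobeniusTopAvoiding j ((n : ℤ) - (j : ℤ)) : ℤ) := by
  rcases Nat.lt_trichotomy n 1 with h | rfl | h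
  · obtain rfl : n = 0 := by omega
    rw [finsum_crankM_zero, numCrankGE_eq_numFrobeniusTopAvoiding 0 j (by omega)]
  · rw [finsum_crankM_one]
    split_ifs with hj
    · subst hj
      rw [sub_self]
      change (1 : ℤ) = ((Finset.univ.filter fun p : Nat.Partition 0 => 1 ∉ frobeniusTop p).card : ℤ)
      rw [Finset.filter_true_of_mem fun p _ => (notMem_frobeniusTop_iff p 1).2 fun i => by
        rw [(isProfile_rowFun p).eq_zero (Nat.zero_le i)]; omega]
      simp
    · rw [← numCrankGE_eq_numFrobeniusTopAvoiding 1 j (by omega), numCrankGE_one]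
      rfl
  · rw [finsum_crankM_of_two_le n j h,
      numCrankGE_eq_numFrobeniusTopAvoiding n j (by omega)]

end CrankFrobenius

theorem mainTheorem6 (n j : ℕ) :
    (¬ (n = 1 ∧ j = 1) →
      CrankFrobenius.numCrankGE j n =
        CrankFrobenius.numFrobeniusTopAvoiding j ((n : ℤ) - (j : ℤ))) ∧
    (∑ᶠ (m : ℤ) (_ : (j : ℤ) ≤ m), CrankFrobenius.crankM m n) =
      (CrankFrobenius.numFrobeniusTopAvoiding j ((n : ℤ) - (j : ℤ)) : ℤ) :=
  ⟨CrankFrobenius.numCrankGE_eq_numFrobeniusTopAvoiding n j,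
    CrankFrobenius.finsum_crankM_eq n j⟩
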